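/- Let $p, m$ be integers with $m \ge p \ge 0$ and let $\Sigma$ be a real symmetric positive definite $p\times p$ matrix. Let $W \sim W_p(m,\Sigma)$, i.e. $W$ is a random matrix with the law of $\sum_{i=1}^m X_i X_i^\top$, where $X_1,\dots,X_m$ are i.i.d. $N_p(0,\Sigma)$ random vectors. Let $V = W^{1/2}$ be its symmetric (positive semidefinite) square root; where $W$ is positive definite, this is the unique positive definite matrix with $V^2 = W$. Then $V$ has a density with respect to the Lebesgue measure $\prod_{1\le i\le j\le p} dv_{ij}$ on the space of real symmetric $p\times p$ matrices, and this density is $$ f(V) = \frac{2^p}{2^{mp/2}\,\Gamma_p(m/2)\,|\Sigma|^{m/2}}\,|V|^{m-p}\exp\!\Big(-\tfrac12 \operatorname{tr}(\Sigma^{-1}V^2)\Big)\prod_{1\le i<j\le p}(\delta_i+\delta_j) $$ for $V$ positive definite, and $f(V)=0$ otherwise. Here $\delta_1,\dots,\delta_p$ are the eigenvalues of $V$ counted with multiplicity, $|\cdot|$ is the determinant, and $\Gamma_p(a)=\pi^{p(p-1)/4}\prod_{i=1}^p\Gamma\big(a-\tfrac{i-1}{2}\big)$ is the multivariate Gamma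 function. -/

import Mathlib

open MeasureTheory ProbabilityTheory
open scoped MatrixOrder

noncomputable section

namespace WishartSqrt

/-- The product `σ`-algebra (generated by the entries) on real matrices. -/
instance instMeasurableSpaceMatrix (p : ℕ) : MeasurableSpace (Matrix (Fin p) (Fin p) ℝ) :=
  inferInstanceAs (MeasurableSpace (Fin p → Fin p → ℝ))

/-- The Wishart distribution `W_p(m, S)`: the law of `∑ i, X i (X i)ᵀ`, where `X 1, …, X m` are
i.i.d. centred Gaussian vectors in `ℝ^p` with covariance matrix `S`. -/
def wishart (p m : ℕ) (S : Matrix (Fin p) (Fin p) ℝ) : Measure (Matrix (Fin p) (Fin p) ℝ) :=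
  (Measure.pi fun _ : Fin m => multivariateGaussian (0 : EuclideanSpace ℝ (Fin p)) S).map
    fun x => ∑ i, Matrix.vecMulVec (x i).ofLp (x i).ofLp

/-- The symmetric matrix with prescribed entries on and above the diagonal. -/
def symOfUpper (p : ℕ) (x : {ij : Fin p × Fin p // ij.1 ≤ ij.2} → ℝ) :
    Matrix (Fin p) (Fin p) ℝ :=
  Matrix.of fun i j => x ⟨(min i j, max i j), min_le_max⟩

/-- Lebesgue measure `∏_{i ≤ j} dv_{ij}` on symmetric matrices, as a measure on all
`p × p` matrices carried by the symmetric ones. -/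
def symLebesgue (p : ℕ) : Measure (Matrix (Fin p) (Fin p) ℝ) :=
  (volume : Measure ({ij : Fin p × Fin p // ij.1 ≤ ij.2} → ℝ)).map (symOfUpper p)

/-- The multivariate Gamma function
`Γ_p(a) = π^{p(p-1)/4} ∏_{i=1}^p Γ(a - (i-1)/2)` (here `i` runs over `0, …, p-1`). -/
def multivariateGamma (p : ℕ) (a : ℝ) : ℝ :=
  Real.pi ^ ((p : ℝ) * ((p : ℝ) - 1) / 4) * ∏ i : Fin p, Real.Gamma (a - (i : ℝ) / 2)

open Classical in
/-- The claimed density of the square root of a `W_p(m, S)` matrix, at the matrix `V`;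
it vanishes off the positive definite matrices. -/
def sqrtDensity (p m : ℕ) (S V : Matrix (Fin p) (Fin p) ℝ) : ℝ :=
  if hV : V.PosDef then
    (2 : ℝ) ^ p /
        ((2 : ℝ) ^ ((m : ℝ) * (p : ℝ) / 2) * multivariateGamma p ((m : ℝ) / 2) *
          S.det ^ ((m : ℝ) / 2)) *
      V.det ^ ((m : ℝ) - (p : ℝ)) *
      Real.exp (-(1 / 2) * (S⁻¹ * V ^ 2).trace) *
      ∏ ij : Fin p × Fin p with ij.1 < ij.2,
        (hV.isHermitian.eigenvalues ij.1 + hV.isHermitian.eigenvalues ij.2)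
  else 0

/-- On positive definite matrices `CFC.sqrt` is the symmetric square root: the unique positive
definite matrix whose square is the given one. -/
theorem eq_sqrt_iff {p : ℕ} {A B : Matrix (Fin p) (Fin p) ℝ} (hA : A.PosDef) :
    B = CFC.sqrt A ↔ B.PosDef ∧ B ^ 2 = A := by
  have hA0 : 0 ≤ A := hA.posSemidef.nonneg
  constructor
  · rintro rfl
    refine ⟨(Matrix.isStrictlyPositive_iff_posDef).1 ?_, CFC.sq_sqrt A⟩
    exact (Matrix.isStrictlyPositive_iff_posDef.2 hA).sqrt
  · rintro ⟨hB, h⟩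
    exact ((CFC.sqrt_eq_iff A B hA0 hB.posSemidef.nonneg).2 (by rw [← h, sq])).symm

end WishartSqrt

end

/-!
`W = ∑ Xᵢ Xᵢᵀ` is the Gram matrix of the `p` columns of the matrix with rows `X₁, …, X_m`, and the
joint Gaussian density of the `Xᵢ` is a function of `W`. So it is enough to push Lebesgue measure on
`p` vectors of `ℝ^m` forward under the Gram matrix. Add one vector at a time: seen through its inner
products `w` with `k` independent vectors of Gram matrix `A` and its squared norm `r`, a vector `z`
has density proportional to `|A|^(-1/2) (r - wᵀ A⁻¹ w)^((m-k)/2-1)`, because `r - wᵀ A⁻¹ w` is the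
squared norm of the component of `z` orthogonal to their span. This quantity is also the Schur
complement `|B| / |A|` of `A` in the Gram matrix `B` of all `k + 1` vectors, so the powers of `|A|`
cancel and induction gives an image measure proportional to `|W|^((m-p-1)/2) dW` on the positive
definite matrices.

Then substitute `W = V²`. The derivative of the squaring map at `V` is the Lyapunov operator
`H ↦ V H + H V`, which in an orthonormal eigenbasis of `V` multiplies the `(i, j)` entry by
`δᵢ + δⱼ`; its determinant on symmetric matrices is therefore
`∏_{i ≤ j} (δᵢ + δⱼ) = 2^p |V| ∏_{i < j} (δᵢ + δⱼ)`.
-/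

namespace WishartSqrt

section Measures

theorem map_withDensity_comp {α β : Type*} [MeasurableSpace α] [MeasurableSpace β] (μ : Measure α)
    {T : α → β} (hT : Measurable T) {f : β → ENNReal} (hf : Measurable f) :
    (μ.withDensity fun x ↦ f (T x)).map T = (μ.map T).withDensity f := by
  ext s hs
  rw [Measure.map_apply hT hs, withDensity_apply _ (hT hs), withDensity_apply _ hs,
    setLIntegral_map hs hf hT]

theorem lintegral_fin_prod_eq_prod {n : ℕ} {α : Fin n → Type*} [∀ i, MeasurableSpace (α i)]
    (μ : ∀ i, Measure (α i)) [∀ i, SigmaFinite (μ i)] {f : ∀ i, α i → ENNReal}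
    (hf : ∀ i, Measurable (f i)) :
    ∫⁻ x, ∏ i, f i (x i) ∂Measure.pi μ = ∏ i, ∫⁻ a, f i a ∂μ i := by
  induction n with
  | zero => simp
  | succ n ih =>
    have hm : Measurable fun x : ∀ i : Fin n, α i.succ ↦ ∏ i, f i.succ (x i) := by fun_prop
    rw [Fin.prod_univ_succ, ← ih _ fun i ↦ hf i.succ,
      ← lintegral_prod_mul (hf 0).aemeasurable hm.aemeasurable]
    refine Eq.trans (lintegral_congr fun x ↦ Fin.prod_univ_succ _)
      ((measurePreserving_piFinSuccAbove μ 0).lintegral_comp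
        (((hf 0).comp measurable_fst).mul (hm.comp measurable_snd)))

variable {ι : Type*} [Fintype ι] {α : ι → Type*} [∀ i, MeasurableSpace (α i)]

theorem lintegral_fintype_prod_eq_prod (μ : ∀ i, Measure (α i)) [∀ i, SigmaFinite (μ i)]
    {f : ∀ i, α i → ENNReal} (hf : ∀ i, Measurable (f i)) :
    ∫⁻ x, ∏ i, f i (x i) ∂Measure.pi μ = ∏ i, ∫⁻ a, f i a ∂μ i := by
  let e := (Fintype.equivFin ι).symm
  rw [← (measurePreserving_piCongrLeft μ e).lintegral_comp (by fun_prop), ← e.prod_comp,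
    ← lintegral_fin_prod_eq_prod _ fun i ↦ hf (e i)]
  refine lintegral_congr fun x ↦ ?_
  rw [← e.prod_comp]
  exact Finset.prod_congr rfl fun i _ ↦ congrArg _ (Equiv.piCongrLeft_apply_apply α e x i)

theorem pi_withDensity (μ : ∀ i, Measure (α i)) [∀ i, SigmaFinite (μ i)]
    {f : ∀ i, α i → ENNReal} (hf : ∀ i, Measurable (f i))
    [∀ i, SigmaFinite ((μ i).withDensity (f i))] :
    Measure.pi (fun i ↦ (μ i).withDensity (f i)) =
      (Measure.pi μ).withDensity fun x ↦ ∏ i, f i (x i) := by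
  refine Measure.pi_eq fun s hs ↦ ?_
  rw [withDensity_apply _ (MeasurableSet.univ_pi hs), Measure.restrict_pi_pi,
    lintegral_fintype_prod_eq_prod _ hf]
  exact Finset.prod_congr rfl fun i _ ↦ (withDensity_apply _ (hs i)).symm

theorem measurable_setLIntegral_rpow_mul_add {X : Type*} [MeasurableSpace X] (a : ℝ)
    {q : X → ℝ} (hq : Measurable q) {H : X × ℝ → ENNReal} (hH : Measurable H) :
    Measurable fun x ↦ ∫⁻ s in Set.Ioi (0 : ℝ), ENNReal.ofReal (s ^ a) * H (x, q x + s) :=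
  Measurable.lintegral_prod_right' (f := fun z : X × ℝ ↦
    ENNReal.ofReal (z.2 ^ a) * H (z.1, q z.1 + z.2)) (by fun_prop)

theorem measurePreserving_curry_symm (ι κ α : Type*) [Fintype ι] [Fintype κ] [MeasureSpace α]
    [SigmaFinite (volume : Measure α)] :
    MeasurePreserving (MeasurableEquiv.curry ι κ α).symm volume volume := by
  refine ⟨MeasurableEquiv.measurable _, (Measure.pi_eq fun s _ ↦ ?_).symm⟩
  have hpre : (MeasurableEquiv.curry ι κ α).symm ⁻¹' (Set.univ.pi s) =
      Set.univ.pi fun i ↦ Set.univ.pi fun j ↦ s (i, j) := by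
    ext x
    simp [MeasurableEquiv.curry, Function.uncurry, Set.mem_pi]
  rw [MeasurableEquiv.map_apply, hpre, volume_pi_pi, Fintype.prod_prod_type]
  simp only [volume_pi_pi]

theorem measurePreserving_swap (ι κ α : Type*) [Fintype ι] [Fintype κ] [MeasureSpace α]
    [SigmaFinite (volume : Measure α)] :
    MeasurePreserving (Function.swap : (ι → κ → α) → κ → ι → α) volume volume :=
  (measurePreserving_curry_symm κ ι α).symm.comp
    ((volume_preserving_arrowCongr' (Equiv.prodComm ι κ) (MeasurableEquiv.refl α)
      (MeasurePreserving.id _)).comp (measurePreserving_curry_symm ι κ α))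

end Measures

section Radial

theorem lintegral_fun_norm_addHaar {F : Type*} [NormedAddCommGroup F] [NormedSpace ℝ F]
    [FiniteDimensional ℝ F] [Nontrivial F] [MeasurableSpace F] [BorelSpace F] (μ : Measure F)
    [μ.IsAddHaarMeasure] {f : ℝ → ENNReal} (hf : Measurable f) :
    ∫⁻ z : F, f ‖z‖ ∂μ = (Module.finrank ℝ F * μ (Metric.ball 0 1)) *
      ∫⁻ r in Set.Ioi (0 : ℝ), ENNReal.ofReal (r ^ (Module.finrank ℝ F - 1)) * f r := by
  calc ∫⁻ z : F, f ‖z‖ ∂μ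
      = ∫⁻ z : ({(0)}ᶜ : Set F), f ‖z.1‖ ∂(μ.comap Subtype.val) := by
        rw [lintegral_subtype_comap (measurableSet_singleton _).compl (fun z : F ↦ f ‖z‖),
          restrict_compl_singleton]
    _ = ∫⁻ z, f z.2 ∂μ.toSphere.prod (.volumeIoiPow (Module.finrank ℝ F - 1)) := by
        simpa using μ.measurePreserving_homeomorphUnitSphereProd.lintegral_comp_emb
          (Homeomorph.measurableEmbedding _) (f ∘ Subtype.val ∘ Prod.snd)
    _ = μ.toSphere Set.univ *
          ∫⁻ r : Set.Ioi (0 : ℝ), f r ∂.volumeIoiPow (Module.finrank ℝ F - 1) := by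
        rw [lintegral_prod _ (by fun_prop)]
        simp [mul_comm]
    _ = _ := by
        rw [Measure.toSphere_apply_univ, Measure.volumeIoiPow,
          lintegral_withDensity_eq_lintegral_mul _ (by fun_prop) (by fun_prop)]
        congr 1
        exact lintegral_subtype_comap measurableSet_Ioi
          (fun r : ℝ ↦ ENNReal.ofReal (r ^ (Module.finrank ℝ F - 1)) * f r)

theorem image_sq_Ioi_zero : (fun r : ℝ ↦ r ^ 2) '' Set.Ioi 0 = Set.Ioi 0 := by
  ext s
  constructor
  · rintro ⟨r, hr : 0 < r, rfl⟩
    exact pow_pos hr 2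
  · exact fun hs ↦ ⟨√s, Real.sqrt_pos.2 hs, Real.sq_sqrt (le_of_lt hs)⟩

theorem lintegral_Ioi_rpow_mul_comp_sq (g : ℝ → ENNReal) (a : ℝ) :
    ∫⁻ r in Set.Ioi (0 : ℝ), ENNReal.ofReal (r ^ (2 * a - 1)) * g (r ^ 2) =
      ENNReal.ofReal (1 / 2) *
        ∫⁻ s in Set.Ioi (0 : ℝ), ENNReal.ofReal (s ^ (a - 1)) * g s := by
  have hinj : Set.InjOn (fun r : ℝ ↦ r ^ 2) (Set.Ioi 0) := fun a ha b hb h ↦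
    (pow_left_inj₀ (le_of_lt ha) (le_of_lt hb) two_ne_zero).1 h
  have key := lintegral_image_eq_lintegral_abs_deriv_mul (f' := fun r ↦ 2 * r) measurableSet_Ioi
    (fun r _ ↦ by simpa using (hasDerivAt_pow 2 r).hasDerivWithinAt) hinj
    (fun s ↦ ENNReal.ofReal (s ^ (a - 1)) * g s)
  rw [image_sq_Ioi_zero] at key
  rw [key, ← lintegral_const_mul' _ _ ENNReal.ofReal_ne_top]
  refine setLIntegral_congr_fun measurableSet_Ioi fun r (hr : 0 < r) ↦ ?_
  rw [← mul_assoc, ← mul_assoc, ← ENNReal.ofReal_mul (by positivity),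
    ← ENNReal.ofReal_mul (by positivity), abs_of_pos (by positivity : 0 < 2 * r)]
  congr 2
  calc r ^ (2 * a - 1) = r ^ (1 + 2 * (a - 1)) := by ring_nf
    _ = r * (r ^ 2) ^ (a - 1) := by
        rw [Real.rpow_add hr, Real.rpow_one, ← Real.rpow_natCast_mul hr.le, Nat.cast_ofNat]
    _ = 1 / 2 * (2 * r) * (r ^ 2) ^ (a - 1) := by ring

variable {E : Type*} [NormedAddCommGroup E] [InnerProductSpace ℝ E] [FiniteDimensional ℝ E]
  [MeasurableSpace E] [BorelSpace E]

theorem lintegral_eq_lintegral_orthogonal (K : Submodule ℝ E) {f : E → ENNReal}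
    (hf : Measurable f) : ∫⁻ y, f y = ∫⁻ u : K, ∫⁻ v : Kᗮ, f (u + v) := by
  have hdecomp := K.orthogonalDecomposition.symm.measurePreserving.comp
    (WithLp.volume_preserving_toLp K Kᗮ)
  have hf' := (hf.comp hdecomp.measurable).aemeasurable (μ := volume.prod volume)
  rw [← hdecomp.lintegral_comp hf]
  refine (lintegral_prod _ hf').trans ?_
  simp

variable [Nontrivial E]

theorem finrank_mul_volume_ball_mul_half :
    Module.finrank ℝ E * volume (Metric.ball (0 : E) 1) * ENNReal.ofReal (1 / 2) =
      ENNReal.ofReal (Real.pi ^ ((Module.finrank ℝ E : ℝ) / 2) /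
        Real.Gamma ((Module.finrank ℝ E : ℝ) / 2)) := by
  set d := Module.finrank ℝ E with hd
  have hd0 : (0 : ℝ) < d := by exact_mod_cast Module.finrank_pos (R := ℝ) (M := E)
  have hpi : √Real.pi ^ d = Real.pi ^ ((d : ℝ) / 2) := by
    rw [Real.sqrt_eq_rpow, ← Real.rpow_mul_natCast Real.pi_pos.le, one_div_mul_eq_div]
  rw [InnerProductSpace.volume_ball, ← hd, ENNReal.ofReal_one, one_pow, one_mul,
    ← ENNReal.ofReal_natCast, ← ENNReal.ofReal_mul (by positivity),
    ← ENNReal.ofReal_mul (by positivity), Real.Gamma_add_one (by positivity), hpi]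
  congr 1
  field_simp

theorem lintegral_fun_norm_sq {g : ℝ → ENNReal} (hg : Measurable g) :
    ∫⁻ z : E, g (‖z‖ ^ 2) =
      ENNReal.ofReal (Real.pi ^ ((Module.finrank ℝ E : ℝ) / 2) /
          Real.Gamma ((Module.finrank ℝ E : ℝ) / 2)) *
        ∫⁻ s in Set.Ioi (0 : ℝ), ENNReal.ofReal (s ^ ((Module.finrank ℝ E : ℝ) / 2 - 1)) * g s := by
  have hexp (r : ℝ) : r ^ (Module.finrank ℝ E - 1) =
      r ^ (2 * ((Module.finrank ℝ E : ℝ) / 2) - 1) := by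
    rw [← Real.rpow_natCast, Nat.cast_pred Module.finrank_pos, mul_div_cancel₀ _ two_ne_zero]
  rw [lintegral_fun_norm_addHaar volume (f := fun r ↦ g (r ^ 2)) (by fun_prop)]
  simp only [hexp]
  rw [lintegral_Ioi_rpow_mul_comp_sq, ← mul_assoc, finrank_mul_volume_ball_mul_half]

end Radial

section InnerProducts

open scoped Matrix

variable {ι : Type*} [Fintype ι] [DecidableEq ι]

variable {E : Type*} [NormedAddCommGroup E] [InnerProductSpace ℝ E]

theorem norm_sq_eq_dotProduct_inv_gram_mulVec {x : ι → E} (hx : LinearIndependent ℝ x) {y : E}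
    (hy : y ∈ Submodule.span ℝ (Set.range x)) :
    ‖y‖ ^ 2 =
      (fun i ↦ inner ℝ (x i) y) ⬝ᵥ (Matrix.gram ℝ x)⁻¹ *ᵥ (fun i ↦ inner ℝ (x i) y) := by
  obtain ⟨c, rfl⟩ := (Submodule.mem_span_range_iff_exists_fun ℝ).1 hy
  have hinner : (fun i ↦ inner ℝ (x i) (∑ j, c j • x j)) = Matrix.gram ℝ x *ᵥ c := by
    ext i
    simp [inner_sum, inner_smul_right, Matrix.mulVec, dotProduct, mul_comm]
  have hdet : IsUnit (Matrix.gram ℝ x).det :=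
    (Matrix.det_gram_ne_zero_iff_linearIndependent.2 hx).isUnit
  rw [hinner, Matrix.mulVec_mulVec, Matrix.nonsing_inv_mul _ hdet, Matrix.one_mulVec,
    dotProduct_comm, ← real_inner_self_eq_norm_sq, ← Matrix.star_dotProduct_gram_mulVec,
    star_trivial]

theorem norm_add_sq_of_mem_orthogonal_span {x : ι → E} (hx : LinearIndependent ℝ x) {u v : E}
    (hu : u ∈ Submodule.span ℝ (Set.range x)) (hv : v ∈ (Submodule.span ℝ (Set.range x))ᗮ) :
    ‖u + v‖ ^ 2 =
      (fun i ↦ inner ℝ (x i) u) ⬝ᵥ (Matrix.gram ℝ x)⁻¹ *ᵥ (fun i ↦ inner ℝ (x i) u) + ‖v‖ ^ 2 := by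
  rw [← norm_sq_eq_dotProduct_inv_gram_mulVec hx hu, sq, sq, sq]
  exact norm_add_sq_eq_norm_sq_add_norm_sq_real (Submodule.inner_right_of_mem_orthogonal hu hv)

variable [FiniteDimensional ℝ E] [MeasurableSpace E] [BorelSpace E]

theorem map_inner_volume {x : ι → E} (hx : LinearIndependent ℝ x)
    (hι : Fintype.card ι = Module.finrank ℝ E) :
    (volume : Measure E).map (fun y i ↦ inner ℝ (x i) y) =
      ENNReal.ofReal (√(Matrix.gram ℝ x).det)⁻¹ • volume := by
  let b : OrthonormalBasis ι ℝ E := (stdOrthonormalBasis ℝ E).reindex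
    (Fintype.equivOfCardEq (by simpa using hι.symm))
  let A : Matrix ι ι ℝ := Matrix.of fun i ↦ (b.repr (x i)).ofLp
  have hinner : (fun (y : E) i ↦ inner ℝ (x i) y) =
      Matrix.toLin' A ∘ WithLp.ofLp ∘ b.repr := by
    ext y i
    rw [← b.repr.inner_map_map, PiLp.inner_apply]
    simp [A, Matrix.mulVec, dotProduct, mul_comm]
  have hgram : (Matrix.gram ℝ x).det = A.det ^ 2 := by
    rw [Matrix.gram_eq_conjTranspose_mul b x, Matrix.det_mul, Matrix.det_conjTranspose,
      star_trivial, ← sq, ← Matrix.det_transpose]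
    rfl
  have hA : A.det ≠ 0 := by
    have := Matrix.det_gram_ne_zero_iff_linearIndependent.2 hx
    rwa [hgram, pow_ne_zero_iff two_ne_zero] at this
  have hb := (PiLp.volume_preserving_ofLp ι).comp b.measurePreserving_repr
  rw [hinner, ← Measure.map_map (Matrix.toLin' A).continuous_of_finiteDimensional.measurable
    hb.measurable, hb.map_eq, Real.map_matrix_volume_pi_eq_smul_volume_pi hA, hgram,
    Real.sqrt_sq_eq_abs, abs_inv]

theorem lintegral_inner_norm_sq {x : ι → E} (hx : LinearIndependent ℝ x)
    (hι : Fintype.card ι < Module.finrank ℝ E) {H : (ι → ℝ) × ℝ → ENNReal} (hH : Measurable H) :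
    ∫⁻ y : E, H (fun i ↦ inner ℝ (x i) y, ‖y‖ ^ 2) =
      ENNReal.ofReal (Real.pi ^ ((Module.finrank ℝ E - Fintype.card ι : ℝ) / 2) /
          Real.Gamma ((Module.finrank ℝ E - Fintype.card ι : ℝ) / 2)) *
        (ENNReal.ofReal (√(Matrix.gram ℝ x).det)⁻¹ * ∫⁻ w, ∫⁻ s in Set.Ioi (0 : ℝ),
          ENNReal.ofReal (s ^ ((Module.finrank ℝ E - Fintype.card ι : ℝ) / 2 - 1)) *
            H (w, w ⬝ᵥ (Matrix.gram ℝ x)⁻¹ *ᵥ w + s)) := by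
  set d : ℝ := Module.finrank ℝ E - Fintype.card ι with hd
  let K := Submodule.span ℝ (Set.range x)
  let x' : ι → K := fun i ↦ ⟨x i, Submodule.subset_span ⟨i, rfl⟩⟩
  have hK : Fintype.card ι = Module.finrank ℝ K := (finrank_span_eq_card hx).symm
  have hfinrank := K.finrank_add_finrank_orthogonal
  have hKd : (Module.finrank ℝ Kᗮ : ℝ) = d := by rw [hd, ← hfinrank, hK]; push_cast; ring
  have : Nontrivial Kᗮ := Module.nontrivial_of_finrank_pos (R := ℝ) (by omega)
  have hinner (u : K) (v : Kᗮ) :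
      (fun i ↦ inner ℝ (x i) (u + v : E)) = fun i ↦ inner ℝ (x' i) u := by
    ext i
    rw [inner_add_right, Submodule.inner_right_of_mem_orthogonal (x' i).2 v.2, add_zero,
      Submodule.coe_inner]
  have hx' : LinearIndependent ℝ x' := LinearIndependent.of_comp K.subtype hx
  let G : (ι → ℝ) → ENNReal := fun w ↦ ∫⁻ s in Set.Ioi (0 : ℝ),
    ENNReal.ofReal (s ^ (d / 2 - 1)) * H (w, w ⬝ᵥ (Matrix.gram ℝ x)⁻¹ *ᵥ w + s)
  have hG : Measurable G := measurable_setLIntegral_rpow_mul_add (d / 2 - 1)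
    (Continuous.measurable (by fun_prop)) hH
  calc ∫⁻ y : E, H (fun i ↦ inner ℝ (x i) y, ‖y‖ ^ 2)
      = ∫⁻ u : K, ∫⁻ v : Kᗮ, H (fun i ↦ inner ℝ (x i) (u + v : E), ‖(u + v : E)‖ ^ 2) :=
        lintegral_eq_lintegral_orthogonal K (hH.comp (by fun_prop))
    _ = ∫⁻ u : K, ENNReal.ofReal (Real.pi ^ (d / 2) / Real.Gamma (d / 2)) *
          G fun i ↦ inner ℝ (x' i) u := by
        refine lintegral_congr fun u ↦ ?_
        simp only [norm_add_sq_of_mem_orthogonal_span hx u.2 (Subtype.prop _),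
          hinner, G, ← hKd]
        exact lintegral_fun_norm_sq (g := fun s ↦ H (fun i ↦ inner ℝ (x' i) u, _ + s)) (by fun_prop)
    _ = _ := by
        rw [lintegral_const_mul' _ _ ENNReal.ofReal_ne_top, ← lintegral_map hG (by fun_prop),
          map_inner_volume hx' hK, lintegral_smul_measure]
        rfl

end InnerProducts

section Border

open scoped Matrix

variable {p : ℕ}

instance instBorelSpaceMatrix (p : ℕ) : BorelSpace (Matrix (Fin p) (Fin p) ℝ) :=
  inferInstanceAs (BorelSpace (Fin p → Fin p → ℝ))

theorem isClosed_posSemidef (n : Type*) [Finite n] :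
    IsClosed {M : Matrix n n ℝ | M.PosSemidef} := by
  have := Fintype.ofFinite n
  simp only [Matrix.posSemidef_iff_dotProduct_mulVec, Set.ofPred_and, Set.ofPred_forall]
  refine IsClosed.inter (isClosed_eq continuous_id.matrix_conjTranspose continuous_id)
    (isClosed_iInter fun x ↦ isClosed_le continuous_const ?_)
  fun_prop

theorem measurableSet_posDef (p : ℕ) :
    MeasurableSet {M : Matrix (Fin p) (Fin p) ℝ | M.PosDef} := by
  have hopen : IsOpen {M : Matrix (Fin p) (Fin p) ℝ | M.det ≠ 0} :=
    isOpen_ne_fun continuous_id.matrix_det continuous_const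
  convert (isClosed_posSemidef (Fin p)).measurableSet.inter hopen.measurableSet using 1
  ext M
  exact ⟨fun h ↦ ⟨h.posSemidef, h.det_pos.ne'⟩, fun h ↦ h.1.posDef_iff_det_ne_zero.2 h.2⟩

/-- The matrix obtained from `W` by adding a first row and a first column, with corner `r` and
both off-diagonal parts equal to `w`. -/
def border (W : Matrix (Fin p) (Fin p) ℝ) (r : ℝ) (w : Fin p → ℝ) :
    Matrix (Fin (p + 1)) (Fin (p + 1)) ℝ :=
  Matrix.of (Fin.cons (Fin.cons r w) fun i ↦ Fin.cons (w i) (W i))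

variable (W : Matrix (Fin p) (Fin p) ℝ) (r : ℝ) (w : Fin p → ℝ)

@[simp] theorem border_zero_zero : border W r w 0 0 = r := rfl

@[simp] theorem border_zero_succ (j : Fin p) : border W r w 0 j.succ = w j := rfl

@[simp] theorem border_succ_zero (i : Fin p) : border W r w i.succ 0 = w i := rfl

@[simp] theorem border_succ_succ (i j : Fin p) : border W r w i.succ j.succ = W i j := rfl

@[fun_prop]
theorem continuous_border {X : Type*} [TopologicalSpace X] {f : X → Matrix (Fin p) (Fin p) ℝ}
    {g : X → ℝ} {h : X → Fin p → ℝ} (hf : Continuous f) (hg : Continuous g) (hh : Continuous h) :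
    Continuous fun a ↦ border (f a) (g a) (h a) :=
  continuous_matrix fun i j ↦ by
    cases i using Fin.cases <;> cases j using Fin.cases <;>
      simp only [border_zero_zero, border_zero_succ, border_succ_zero, border_succ_succ] <;>
      fun_prop

/-- The splitting of the indices `0, …, p` into the first one and the others. -/
def finSuccSumEquiv (p : ℕ) : Unit ⊕ Fin p ≃ Fin (p + 1) :=
  (Equiv.sumComm _ _).trans ((Equiv.optionEquivSumPUnit _).symm.trans (finSuccEquiv p).symm)

theorem submatrix_border : (border W r w).submatrix (finSuccSumEquiv p) (finSuccSumEquiv p) =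
    Matrix.fromBlocks (Matrix.diagonal fun _ ↦ r) (Matrix.replicateRow Unit w)
      (Matrix.replicateRow Unit w)ᴴ W := by
  ext (i | i) (j | j) <;> simp [finSuccSumEquiv]

theorem schurComplement_border :
    (Matrix.diagonal fun _ : Unit ↦ r) -
        Matrix.replicateRow Unit w * W⁻¹ * (Matrix.replicateRow Unit w)ᴴ =
      Matrix.diagonal fun _ ↦ r - w ⬝ᵥ W⁻¹ *ᵥ w := by
  ext
  simp [Matrix.mul_assoc, Matrix.mul_apply, Matrix.mulVec, dotProduct]

variable {W}

theorem det_border (hW : IsUnit W.det) :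
    (border W r w).det = W.det * (r - w ⬝ᵥ W⁻¹ *ᵥ w) := by
  have := W.invertibleOfIsUnitDet hW
  rw [← Matrix.det_submatrix_equiv_self (finSuccSumEquiv p), submatrix_border,
    Matrix.det_fromBlocks₂₂, Matrix.invOf_eq_nonsing_inv, schurComplement_border,
    Matrix.det_diagonal, Fintype.prod_unique]

theorem posDef_border_iff :
    (border W r w).PosDef ↔ W.PosDef ∧ w ⬝ᵥ W⁻¹ *ᵥ w < r := by
  rw [← sub_pos]
  constructor
  · intro h
    have hW : W.PosDef := h.submatrix (Fin.succ_injective p)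
    have hdet := h.det_pos
    rw [det_border r w hW.det_pos.ne'.isUnit] at hdet
    exact ⟨hW, (mul_pos_iff_of_pos_left hW.det_pos).1 hdet⟩
  · rintro ⟨hW, hr⟩
    have := hW.isUnit.invertible
    have hdet := det_border r w hW.det_pos.ne'.isUnit
    refine (Matrix.PosSemidef.posDef_iff_det_ne_zero ?_).2
      (hdet.trans_ne (mul_pos hW.det_pos hr).ne')
    rw [← Matrix.posSemidef_submatrix_equiv (finSuccSumEquiv p), submatrix_border,
      Matrix.PosDef.fromBlocks₂₂ _ _ hW, schurComplement_border]
    exact Matrix.PosSemidef.diagonal fun _ ↦ hr.le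

end Border

section Upper

/-- The positions on and above the diagonal, which index the coordinates of the space of symmetric
`p × p` matrices. -/
abbrev UpperIndex (p : ℕ) : Type := {ij : Fin p × Fin p // ij.1 ≤ ij.2}

variable {p : ℕ}

/-- The position on or above the diagonal that holds the `(i, j)` entry of a symmetric matrix. -/
def upperIndex (i j : Fin p) : UpperIndex p :=
  ⟨(min i j, max i j), min_le_max⟩

/-- The entries on and above the diagonal; on symmetric matrices this inverts `symOfUpper`. -/
def upper (M : Matrix (Fin p) (Fin p) ℝ) (ij : UpperIndex p) : ℝ :=
  M ij.1.1 ij.1.2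

theorem symOfUpper_apply (x : UpperIndex p → ℝ) (i j : Fin p) :
    symOfUpper p x i j = x (upperIndex i j) := rfl

theorem upperIndex_comm (i j : Fin p) : upperIndex i j = upperIndex j i := by
  simp only [upperIndex, min_comm, max_comm]

theorem upperIndex_fst_snd (ij : UpperIndex p) : upperIndex ij.1.1 ij.1.2 = ij :=
  Subtype.ext (Prod.ext (min_eq_left ij.2) (max_eq_right ij.2))

theorem upper_symOfUpper (x : UpperIndex p → ℝ) : upper (symOfUpper p x) = x := by
  funext ij
  rw [upper, symOfUpper_apply, upperIndex_fst_snd]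

theorem symOfUpper_upper {M : Matrix (Fin p) (Fin p) ℝ} (hM : M.IsSymm) :
    symOfUpper p (upper M) = M := by
  ext i j
  rcases le_total i j with h | h <;> simp [symOfUpper_apply, upper, upperIndex, h, hM.apply]

theorem isSymm_symOfUpper (x : UpperIndex p → ℝ) : (symOfUpper p x).IsSymm := by
  ext i j
  rw [Matrix.transpose_apply, symOfUpper_apply, symOfUpper_apply, upperIndex_comm]

theorem continuous_symOfUpper : Continuous (symOfUpper p) :=
  continuous_matrix fun i j ↦ continuous_apply (upperIndex i j)

theorem continuous_upper : Continuous (upper : Matrix (Fin p) (Fin p) ℝ → _) :=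
  continuous_pi fun ij ↦ continuous_id.matrix_elem ij.1.1 ij.1.2

theorem measurableEmbedding_symOfUpper : MeasurableEmbedding (symOfUpper p) :=
  (Function.LeftInverse.isClosedEmbedding upper_symOfUpper continuous_upper
    continuous_symOfUpper).measurableEmbedding

/-- The entries on and above the diagonal of a bordered matrix are those of the original matrix and
those of the new first row. -/
def borderIndex (p : ℕ) : UpperIndex p ⊕ Fin (p + 1) ≃ UpperIndex (p + 1) where
  toFun := Sum.elim (fun ij ↦ ⟨(ij.1.1.succ, ij.1.2.succ), Fin.succ_le_succ_iff.2 ij.2⟩)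
    fun j ↦ ⟨(0, j), Fin.zero_le j⟩
  invFun ij := if h : ij.1.1 = 0 then .inr ij.1.2 else
    .inl ⟨(ij.1.1.pred h, ij.1.2.pred (Fin.pos_iff_ne_zero.1
      ((Fin.pos_iff_ne_zero.2 h).trans_le ij.2))), by simpa only [Fin.pred_le_pred_iff] using ij.2⟩
  left_inv := by rintro (ij | j) <;> simp
  right_inv ij := by
    by_cases h : ij.1.1 = 0
    · ext <;> simp [h]
    · ext <;> simp [h]

theorem symOfUpper_succ (x : UpperIndex (p + 1) → ℝ) :
    symOfUpper (p + 1) x = border (symOfUpper p fun ij ↦ x (borderIndex p (.inl ij)))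
      (x (borderIndex p (.inr 0))) fun j ↦ x (borderIndex p (.inr j.succ)) := by
  ext i j
  cases i using Fin.cases <;> cases j using Fin.cases
  · rfl
  · rfl
  · rw [symOfUpper_apply, upperIndex_comm]
    rfl
  case succ.succ i j =>
    rw [symOfUpper_apply, border_succ_succ, symOfUpper_apply]
    congr 1
    ext <;> simp [upperIndex, borderIndex]

theorem measurePreserving_comp_borderIndex (p : ℕ) :
    MeasurePreserving fun x : UpperIndex (p + 1) → ℝ ↦
      ((fun ij ↦ x (borderIndex p (.inl ij)) : UpperIndex p → ℝ),
        (x (borderIndex p (.inr 0)), fun j : Fin p ↦ x (borderIndex p (.inr j.succ)))) :=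
  ((MeasurePreserving.id volume).prod (volume_preserving_piFinSuccAbove (fun _ ↦ ℝ) 0)).comp
    ((volume_measurePreserving_sumPiEquivProdPi fun _ ↦ ℝ).comp
      (volume_measurePreserving_piCongrLeft (fun _ ↦ ℝ) (borderIndex p)).symm)

theorem symLebesgue_succ (p : ℕ) :
    symLebesgue (p + 1) = ((symLebesgue p).prod volume).map
      fun z : _ × ℝ × (Fin p → ℝ) ↦ border z.1 z.2.1 z.2.2 := by
  have hsplit := measurePreserving_comp_borderIndex p
  have hborder : Measurable fun z : Matrix (Fin p) (Fin p) ℝ × ℝ × (Fin p → ℝ) ↦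
      border z.1 z.2.1 z.2.2 := Continuous.measurable (by fun_prop)
  have hsym := continuous_symOfUpper (p := p).measurable
  have hprod := hsym.prodMap (measurable_id (α := ℝ × (Fin p → ℝ)))
  rw [← Measure.map_id (μ := (volume : Measure (ℝ × (Fin p → ℝ)))), symLebesgue, symLebesgue,
    Measure.map_prod_map _ _ hsym measurable_id, Measure.map_map hborder hprod,
    ← Measure.volume_eq_prod, ← hsplit.map_eq,
    Measure.map_map (hborder.comp hprod) hsplit.measurable]
  exact congrArg (Measure.map · volume) (funext symOfUpper_succ)

end Upper

section Gram

open scoped Matrix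

/-- The function `W ↦ |W|^a` on positive definite matrices, extended by zero. -/
noncomputable def detRpow {p : ℕ} (a : ℝ) : Matrix (Fin p) (Fin p) ℝ → ENNReal :=
  {W | W.PosDef}.indicator fun W ↦ ENNReal.ofReal (W.det ^ a)

section DetRpow

variable {p : ℕ} {W : Matrix (Fin p) (Fin p) ℝ} (a : ℝ)

theorem detRpow_of_posDef (hW : W.PosDef) : detRpow a W = ENNReal.ofReal (W.det ^ a) :=
  Set.indicator_of_mem (show W ∈ {W | W.PosDef} from hW) _

theorem detRpow_of_not_posDef (hW : ¬ W.PosDef) : detRpow a W = 0 :=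
  Set.indicator_of_notMem (show W ∉ {W | W.PosDef} from hW) _

theorem measurable_det : Measurable (Matrix.det : Matrix (Fin p) (Fin p) ℝ → ℝ) :=
  continuous_id.matrix_det.measurable

@[fun_prop]
theorem measurable_detRpow : Measurable (detRpow a : Matrix (Fin p) (Fin p) ℝ → ENNReal) :=
  (measurable_det.pow_const a).ennreal_ofReal.indicator (measurableSet_posDef p)

theorem detRpow_mul_ofReal_det_rpow_neg (hW : W.PosDef) :
    detRpow a W * ENNReal.ofReal (W.det ^ (-a)) = 1 := by
  rw [detRpow_of_posDef a hW, ← ENNReal.ofReal_mul (Real.rpow_nonneg hW.det_pos.le _),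
    ← Real.rpow_add hW.det_pos, add_neg_cancel, Real.rpow_zero, ENNReal.ofReal_one]

theorem detRpow_border (hW : W.PosDef) (w : Fin p → ℝ) (s : ℝ) :
    detRpow a (border W (w ⬝ᵥ W⁻¹ *ᵥ w + s) w) =
      ENNReal.ofReal (W.det ^ a) * (Set.Ioi 0).indicator (fun s ↦ ENNReal.ofReal (s ^ a)) s := by
  by_cases hs : 0 < s
  · have hB : (border W (w ⬝ᵥ W⁻¹ *ᵥ w + s) w).PosDef :=
      (posDef_border_iff _ w).2 ⟨hW, lt_add_of_pos_right _ hs⟩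
    rw [detRpow_of_posDef a hB, det_border _ w hW.det_pos.ne'.isUnit, add_sub_cancel_left,
      Real.mul_rpow hW.det_pos.le hs.le, ENNReal.ofReal_mul (Real.rpow_nonneg hW.det_pos.le a),
      Set.indicator_of_mem (Set.mem_Ioi.2 hs)]
  · have hB : ¬ (border W (w ⬝ᵥ W⁻¹ *ᵥ w + s) w).PosDef := fun h ↦
      hs (pos_of_lt_add_right ((posDef_border_iff _ w).1 h).2)
    rw [detRpow_of_not_posDef a hB, Set.indicator_of_notMem (by simpa using hs), mul_zero]

theorem lintegral_detRpow_border (hW : W.PosDef) (w : Fin p → ℝ)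
    (F : Matrix (Fin (p + 1)) (Fin (p + 1)) ℝ → ENNReal) :
    ∫⁻ r, detRpow a (border W r w) * F (border W r w) =
      ENNReal.ofReal (W.det ^ a) * ∫⁻ s in Set.Ioi (0 : ℝ),
        ENNReal.ofReal (s ^ a) * F (border W (w ⬝ᵥ W⁻¹ *ᵥ w + s) w) := by
  rw [← lintegral_const_mul' _ _ ENNReal.ofReal_ne_top, ← lintegral_indicator measurableSet_Ioi,
    ← lintegral_add_left_eq_self _ (w ⬝ᵥ W⁻¹ *ᵥ w)]
  refine lintegral_congr fun s ↦ ?_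
  rw [detRpow_border a hW]
  by_cases hs : s ∈ Set.Ioi 0 <;> simp [hs, mul_assoc]

end DetRpow

section Constants

theorem multivariateGamma_pos {p : ℕ} {a : ℝ} (h : (p : ℝ) ≤ 2 * a) :
    0 < multivariateGamma p a := by
  refine mul_pos (Real.rpow_pos_of_pos Real.pi_pos _) (Finset.prod_pos fun i _ ↦
    Real.Gamma_pos_of_pos ?_)
  have : (i : ℝ) < p := by exact_mod_cast i.2
  linarith

theorem multivariateGamma_succ (p : ℕ) (a : ℝ) : multivariateGamma (p + 1) a =
    Real.pi ^ ((p : ℝ) / 2) * multivariateGamma p a * Real.Gamma (a - (p : ℝ) / 2) := by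
  have hexp : ((p + 1 : ℕ) : ℝ) * (((p + 1 : ℕ) : ℝ) - 1) / 4 =
      (p : ℝ) / 2 + (p : ℝ) * (p - 1) / 4 := by push_cast; ring
  rw [multivariateGamma, multivariateGamma, Fin.prod_univ_castSucc, hexp,
    Real.rpow_add Real.pi_pos]
  simp only [Fin.val_castSucc, Fin.val_last, mul_assoc]

/-- The total mass factor `π^{mp/2} / Γ_p(m/2)` of the push-forward of Lebesgue measure on
`p`-tuples of vectors in dimension `m` under the Gram matrix. -/
noncomputable def gramConst (p m : ℕ) : ℝ :=
  Real.pi ^ ((m : ℝ) * p / 2) / multivariateGamma p ((m : ℝ) / 2)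

theorem gramConst_zero (m : ℕ) : gramConst 0 m = 1 := by
  simp [gramConst, multivariateGamma]

theorem gramConst_pos {p m : ℕ} (h : p ≤ m) : 0 < gramConst p m := by
  have hpm : (p : ℝ) ≤ m := by exact_mod_cast h
  exact div_pos (Real.rpow_pos_of_pos Real.pi_pos _) (multivariateGamma_pos (by linarith))

theorem gramConst_succ (p m : ℕ) : gramConst (p + 1) m =
    gramConst p m * (Real.pi ^ ((m - p : ℝ) / 2) / Real.Gamma ((m - p : ℝ) / 2)) := by
  have hexp : (m : ℝ) * ((p + 1 : ℕ) : ℝ) / 2 =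
      (p : ℝ) / 2 + (m : ℝ) * p / 2 + (m - p : ℝ) / 2 := by push_cast; ring
  have hpi := Real.rpow_pos_of_pos Real.pi_pos ((p : ℝ) / 2)
  rw [gramConst, gramConst, multivariateGamma_succ, hexp, Real.rpow_add Real.pi_pos,
    Real.rpow_add Real.pi_pos, ← sub_div, ← mul_div_mul_comm, mul_assoc, mul_assoc,
    mul_div_mul_left _ _ hpi.ne']

end Constants

theorem ae_posDef_withDensity_detRpow {p : ℕ} (μ : Measure (Matrix (Fin p) (Fin p) ℝ))
    (c : ENNReal) (a : ℝ) : ∀ᵐ W ∂μ.withDensity fun W ↦ c * detRpow a W, W.PosDef := by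
  refine (ae_withDensity_iff ((measurable_detRpow a).const_mul c)).2 (ae_of_all _ fun W hW ↦ ?_)
  by_contra h
  exact hW (by rw [detRpow_of_not_posDef a h, mul_zero])

section Border

variable {p : ℕ} {G : Matrix (Fin (p + 1)) (Fin (p + 1)) ℝ → ENNReal}

theorem measurable_lintegral_border (hG : Measurable G) :
    Measurable fun W : Matrix (Fin p) (Fin p) ℝ ↦ ∫⁻ w, ∫⁻ r, G (border W r w) := by
  have hborder : Measurable fun z : (Matrix (Fin p) (Fin p) ℝ × (Fin p → ℝ)) × ℝ ↦
      G (border z.1.1 z.2 z.1.2) := hG.comp (Continuous.measurable (by fun_prop))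
  exact hborder.lintegral_prod_right'.lintegral_prod_right'

theorem measurable_det_rpow_mul_lintegral_border (a b : ℝ)
    {F : Matrix (Fin (p + 1)) (Fin (p + 1)) ℝ → ENNReal} (hF : Measurable F) :
    Measurable fun W : Matrix (Fin p) (Fin p) ℝ ↦ ENNReal.ofReal (W.det ^ a) *
      ∫⁻ w, ∫⁻ r, detRpow b (border W r w) * F (border W r w) :=
  (measurable_det.pow_const a).ennreal_ofReal.mul
    (measurable_lintegral_border ((measurable_detRpow b).mul hF))

theorem lintegral_symLebesgue_succ (hG : Measurable G) :
    ∫⁻ B, G B ∂symLebesgue (p + 1) =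
      ∫⁻ W, (∫⁻ w, ∫⁻ r, G (border W r w)) ∂symLebesgue p := by
  have hborder : Measurable fun z : Matrix (Fin p) (Fin p) ℝ × ℝ × (Fin p → ℝ) ↦
      border z.1 z.2.1 z.2.2 := Continuous.measurable (by fun_prop)
  have hcomp := (hG.comp hborder).aemeasurable (μ := (symLebesgue p).prod volume)
  simp only [Function.comp_def] at hcomp
  rw [symLebesgue_succ, lintegral_map hG hborder, lintegral_prod _ hcomp]
  refine lintegral_congr fun W ↦ ?_
  rw [Measure.volume_eq_prod, lintegral_prod_symm]
  exact (hG.comp (Continuous.measurable (by fun_prop : Continuous fun z : ℝ × (Fin p → ℝ) ↦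
    border W z.1 z.2))).aemeasurable

theorem lintegral_detRpow_mul_lintegral_border (c : ENNReal) (a b : ℝ)
    {F : Matrix (Fin (p + 1)) (Fin (p + 1)) ℝ → ENNReal} (hF : Measurable F) :
    ∫⁻ W, (ENNReal.ofReal (W.det ^ (-a)) *
        ∫⁻ w, ∫⁻ r, detRpow b (border W r w) * F (border W r w))
          ∂(symLebesgue p).withDensity (fun W ↦ c * detRpow a W) =
      c * ∫⁻ B, detRpow b B * F B ∂symLebesgue (p + 1) := by
  have hG := (measurable_detRpow b).mul hF
  have hI := measurable_lintegral_border hG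
  simp only [Pi.mul_def] at hG hI
  rw [lintegral_withDensity_eq_lintegral_mul _ ((measurable_detRpow a).const_mul c)
    (measurable_det_rpow_mul_lintegral_border _ b hF), lintegral_symLebesgue_succ hG,
    ← lintegral_const_mul _ hI]
  refine lintegral_congr fun W ↦ ?_
  by_cases hW : W.PosDef
  · simp only [Pi.mul_apply]
    rw [mul_assoc, ← mul_assoc (detRpow a W), detRpow_mul_ofReal_det_rpow_neg a hW, one_mul]
  · have hB : ∀ r w, ¬ (border W r w).PosDef := fun r w h ↦ hW ((posDef_border_iff r w).1 h).1
    simp [detRpow_of_not_posDef _ hW, detRpow_of_not_posDef _ (hB _ _)]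

end Border

variable {E : Type*} [NormedAddCommGroup E] [InnerProductSpace ℝ E] {p : ℕ}

theorem gram_cons (y : E) (x : Fin p → E) : Matrix.gram ℝ (Fin.cons y x : Fin (p + 1) → E) =
    border (Matrix.gram ℝ x) (‖y‖ ^ 2) fun i ↦ inner ℝ (x i) y := by
  ext i j
  cases i using Fin.cases <;> cases j using Fin.cases <;> simp [real_inner_comm]

theorem continuous_gram : Continuous (Matrix.gram ℝ : (Fin p → E) → _) :=
  continuous_matrix fun i j ↦ by simp only [Matrix.gram_apply]; fun_prop

variable [FiniteDimensional ℝ E] [MeasurableSpace E] [BorelSpace E]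

theorem lintegral_gram_cons (hp : p < Module.finrank ℝ E) {x : Fin p → E}
    (hx : (Matrix.gram ℝ x).PosDef) {F : Matrix (Fin (p + 1)) (Fin (p + 1)) ℝ → ENNReal}
    (hF : Measurable F) :
    ∫⁻ y, F (Matrix.gram ℝ (Fin.cons y x : Fin (p + 1) → E)) =
      ENNReal.ofReal (Real.pi ^ ((Module.finrank ℝ E - p : ℝ) / 2) /
          Real.Gamma ((Module.finrank ℝ E - p : ℝ) / 2)) *
        (ENNReal.ofReal ((Matrix.gram ℝ x).det ^ (-((Module.finrank ℝ E - p - 1 : ℝ) / 2))) *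
          ∫⁻ w, ∫⁻ r, detRpow ((Module.finrank ℝ E - p : ℝ) / 2 - 1)
            (border (Matrix.gram ℝ x) r w) * F (border (Matrix.gram ℝ x) r w)) := by
  have hd := hx.det_pos
  have hH : Measurable fun z : (Fin p → ℝ) × ℝ ↦ F (border (Matrix.gram ℝ x) z.2 z.1) :=
    hF.comp (Continuous.measurable (by fun_prop))
  have hlaw := lintegral_inner_norm_sq (Matrix.linearIndependent_of_posDef_gram hx)
    (by simpa using hp) hH
  simp only [Fintype.card_fin] at hlaw
  simp only [gram_cons, hlaw, lintegral_detRpow_border _ hx]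
  rw [lintegral_const_mul' _ _ ENNReal.ofReal_ne_top, ← mul_assoc (ENNReal.ofReal (_ ^ _)),
    ← ENNReal.ofReal_mul (Real.rpow_nonneg hd.le _), ← Real.rpow_add hd, Real.sqrt_eq_rpow,
    ← Real.rpow_neg hd.le]
  ring_nf

theorem lintegral_gram_succ (hp : p < Module.finrank ℝ E)
    (hae : ∀ᵐ x : Fin p → E, (Matrix.gram ℝ x).PosDef)
    {F : Matrix (Fin (p + 1)) (Fin (p + 1)) ℝ → ENNReal} (hF : Measurable F) :
    ∫⁻ x : Fin (p + 1) → E, F (Matrix.gram ℝ x) =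
      ENNReal.ofReal (Real.pi ^ ((Module.finrank ℝ E - p : ℝ) / 2) /
          Real.Gamma ((Module.finrank ℝ E - p : ℝ) / 2)) *
        ∫⁻ W, (ENNReal.ofReal (W.det ^ (-((Module.finrank ℝ E - p - 1 : ℝ) / 2))) *
          ∫⁻ w, ∫⁻ r, detRpow ((Module.finrank ℝ E - p : ℝ) / 2 - 1) (border W r w) *
            F (border W r w)) ∂(volume : Measure (Fin p → E)).map (Matrix.gram ℝ) := by
  have hcons : Measurable fun z : E × (Fin p → E) ↦
      F (Matrix.gram ℝ (Fin.cons z.1 z.2 : Fin (p + 1) → E)) :=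
    hF.comp (continuous_gram.comp (by fun_prop)).measurable
  rw [← (volume_preserving_piFinSuccAbove (fun _ : Fin (p + 1) ↦ E) 0).symm.lintegral_comp_emb
    (MeasurableEquiv.measurableEmbedding _), Measure.volume_eq_prod]
  simp only [MeasurableEquiv.piFinSuccAbove_symm_apply, Fin.insertNthEquiv_zero,
    Fin.consEquiv, Equiv.coe_fn_mk]
  rw [lintegral_prod_symm _ hcons.aemeasurable,
    lintegral_map (measurable_det_rpow_mul_lintegral_border _ _ hF) continuous_gram.measurable,
    ← lintegral_const_mul' _ _ ENNReal.ofReal_ne_top]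
  exact lintegral_congr_ae (hae.mono fun x hx ↦ lintegral_gram_cons hp hx hF)

theorem map_gram_volume (hp : p ≤ Module.finrank ℝ E) :
    (volume : Measure (Fin p → E)).map (Matrix.gram ℝ) =
      (symLebesgue p).withDensity fun W ↦ ENNReal.ofReal (gramConst p (Module.finrank ℝ E)) *
        detRpow ((Module.finrank ℝ E - p - 1 : ℝ) / 2) W := by
  induction p with
  | zero =>
    have hone (W : Matrix (Fin 0) (Fin 0) ℝ) (a : ℝ) : detRpow a W = 1 := by
      rw [Subsingleton.elim W 1, detRpow_of_posDef a Matrix.PosDef.one]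
      simp
    have : IsEmpty (UpperIndex 0) := ⟨fun ij ↦ ij.1.1.elim0⟩
    simp only [gramConst_zero, hone, ENNReal.ofReal_one, mul_one, ← Pi.one_def, withDensity_one,
      symLebesgue]
    rw [Measure.volume_pi_eq_dirac, Measure.volume_pi_eq_dirac, Measure.map_dirac,
      Measure.map_dirac, Subsingleton.elim (Matrix.gram ℝ _) (symOfUpper 0 _)]
  | succ p ih =>
    have ih := ih (Nat.le_of_succ_le hp)
    have hae : ∀ᵐ x : Fin p → E, (Matrix.gram ℝ x).PosDef :=
      ae_of_ae_map continuous_gram.aemeasurable (ih ▸ ae_posDef_withDensity_detRpow ..)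
    have hexp : (Module.finrank ℝ E - (p + 1 : ℕ) - 1 : ℝ) / 2 =
        (Module.finrank ℝ E - p : ℝ) / 2 - 1 := by push_cast; ring
    refine Measure.ext_of_lintegral _ fun F hF ↦ ?_
    rw [lintegral_map hF continuous_gram.measurable, lintegral_gram_succ hp hae hF, ih,
      lintegral_detRpow_mul_lintegral_border _ _ _ hF, ← mul_assoc, mul_comm (ENNReal.ofReal _),
      ← ENNReal.ofReal_mul (gramConst_pos (Nat.le_of_succ_le hp)).le, ← gramConst_succ, hexp,
      lintegral_withDensity_eq_lintegral_mul _ ((measurable_detRpow _).const_mul _) hF,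
      ← lintegral_const_mul' _ _ ENNReal.ofReal_ne_top]
    simp only [Pi.mul_apply, mul_assoc]

end Gram

section Gaussian

open scoped Matrix

variable {ι : Type*} [Fintype ι] [DecidableEq ι]

theorem mulVec_dotProduct_inv_mulVec {R : Type*} [CommRing R] {A : Matrix ι ι R}
    (hA : IsUnit A.det) (u : ι → R) : (A *ᵥ u) ⬝ᵥ (A * Aᵀ)⁻¹ *ᵥ (A *ᵥ u) = u ⬝ᵥ u := by
  rw [Matrix.mul_inv_rev, Matrix.mulVec_mulVec, Matrix.nonsing_inv_mul_cancel_right _ _ hA,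
    ← Matrix.transpose_nonsing_inv, Matrix.mulVec_transpose, dotProduct_comm,
    ← Matrix.dotProduct_mulVec, Matrix.mulVec_mulVec, Matrix.nonsing_inv_mul _ hA,
    Matrix.one_mulVec]

/-- The Lebesgue density of the centred Gaussian vector with positive definite covariance
matrix `S`. -/
noncomputable def multivariateGaussianPDFReal (S : Matrix ι ι ℝ) (y : EuclideanSpace ℝ ι) : ℝ :=
  (√(2 * Real.pi))⁻¹ ^ Fintype.card ι * (√S.det)⁻¹ *
    Real.exp (-(1 / 2) * (y.ofLp ⬝ᵥ S⁻¹ *ᵥ y.ofLp))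

theorem multivariateGaussianPDFReal_nonneg (S : Matrix ι ι ℝ) (y : EuclideanSpace ℝ ι) :
    0 ≤ multivariateGaussianPDFReal S y := by
  unfold multivariateGaussianPDFReal
  positivity

@[fun_prop]
theorem measurable_multivariateGaussianPDFReal (S : Matrix ι ι ℝ) :
    Measurable (multivariateGaussianPDFReal S) := by
  have hquad : Continuous fun y : EuclideanSpace ℝ ι ↦ y.ofLp ⬝ᵥ S⁻¹ *ᵥ y.ofLp :=
    (PiLp.continuous_ofLp 2 _).dotProduct
      (continuous_const.matrix_mulVec (PiLp.continuous_ofLp 2 _))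
  exact ((hquad.measurable.const_mul _).exp).const_mul _

theorem multivariateGaussianPDFReal_one (y : EuclideanSpace ℝ ι) :
    multivariateGaussianPDFReal 1 y = ∏ i, gaussianPDFReal 0 1 (y i) := by
  simp only [multivariateGaussianPDFReal, gaussianPDFReal, NNReal.coe_one, mul_one, sub_zero,
    Finset.prod_mul_distrib, Finset.prod_const, Finset.card_univ, ← Real.exp_sum,
    Matrix.det_one, Real.sqrt_one, inv_one, Matrix.one_mulVec]
  congr 2
  rw [dotProduct, Finset.mul_sum]
  exact Finset.sum_congr rfl fun i _ ↦ by ring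

theorem abs_det_mul_multivariateGaussianPDFReal {A : Matrix ι ι ℝ} (hA : IsUnit A.det)
    (y : EuclideanSpace ℝ ι) :
    |A.det| * multivariateGaussianPDFReal (A * Aᵀ) (Matrix.toEuclideanCLM (𝕜 := ℝ) A y) =
      multivariateGaussianPDFReal 1 y := by
  have hdet : |A.det| ≠ 0 := abs_ne_zero.2 hA.ne_zero
  rw [multivariateGaussianPDFReal, multivariateGaussianPDFReal, Matrix.ofLp_toEuclideanCLM,
    mulVec_dotProduct_inv_mulVec hA, Matrix.det_mul, Matrix.det_transpose,
    Real.sqrt_mul_self_eq_abs]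
  simp only [Matrix.det_one, Real.sqrt_one, inv_one, Matrix.one_mulVec]
  field_simp

theorem stdGaussian_eq_withDensity : stdGaussian (EuclideanSpace ℝ ι) =
    volume.withDensity fun y ↦ ENNReal.ofReal (multivariateGaussianPDFReal 1 y) := by
  have hreal : gaussianReal 0 1 = volume.withDensity (gaussianPDF 0 1) :=
    gaussianReal_of_var_ne_zero 0 one_ne_zero
  have : SigmaFinite ((volume : Measure ℝ).withDensity (gaussianPDF 0 1)) :=
    hreal ▸ inferInstance
  have hpdf (x : ι → ℝ) : ∏ i, gaussianPDF 0 1 (x i) =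
      ENNReal.ofReal (multivariateGaussianPDFReal 1 (WithLp.toLp 2 x)) := by
    rw [multivariateGaussianPDFReal_one,
      ENNReal.ofReal_prod_of_nonneg fun i _ ↦ gaussianPDFReal_nonneg _ _ _]
    rfl
  rw [← map_pi_eq_stdGaussian, hreal, pi_withDensity _ fun _ ↦ measurable_gaussianPDF 0 1]
  simp only [hpdf]
  rw [map_withDensity_comp _ (T := WithLp.toLp 2) (by fun_prop)
    (f := fun y ↦ ENNReal.ofReal (multivariateGaussianPDFReal 1 y)) (by fun_prop), ← volume_pi,
    (PiLp.volume_preserving_toLp ι).map_eq]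

theorem map_toEuclideanCLM_volume {A : Matrix ι ι ℝ} (hA : IsUnit A.det) :
    (volume : Measure (EuclideanSpace ℝ ι)).map (Matrix.toEuclideanCLM (𝕜 := ℝ) A) =
      ENNReal.ofReal |A.det|⁻¹ • volume := by
  have hdet : LinearMap.det (Matrix.toEuclideanLin A) = A.det := by
    rw [Matrix.toEuclideanLin_eq_toLin_orthonormal, LinearMap.det_toLin]
  have hmap := Measure.map_linearMap_addHaar_eq_smul_addHaar (f := Matrix.toEuclideanLin A) volume
    (by rw [hdet]; exact hA.ne_zero)
  rw [hdet, abs_inv] at hmap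
  exact hmap

theorem map_toEuclideanCLM_stdGaussian {A : Matrix ι ι ℝ} (hA : IsUnit A.det) :
    (stdGaussian (EuclideanSpace ℝ ι)).map (Matrix.toEuclideanCLM (𝕜 := ℝ) A) =
      volume.withDensity fun y ↦ ENNReal.ofReal (multivariateGaussianPDFReal (A * Aᵀ) y) := by
  have hdet : 0 < |A.det| := abs_pos.2 hA.ne_zero
  have hpdf : Measurable fun y : EuclideanSpace ℝ ι ↦
      ENNReal.ofReal (multivariateGaussianPDFReal (A * Aᵀ) y) := by fun_prop
  have hstd : stdGaussian (EuclideanSpace ℝ ι) = volume.withDensity fun y ↦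
      (ENNReal.ofReal |A.det| • fun y ↦ ENNReal.ofReal (multivariateGaussianPDFReal (A * Aᵀ) y))
        (Matrix.toEuclideanCLM (𝕜 := ℝ) A y) := by
    simp only [stdGaussian_eq_withDensity, Pi.smul_apply, smul_eq_mul,
      ← ENNReal.ofReal_mul hdet.le, abs_det_mul_multivariateGaussianPDFReal hA]
  rw [hstd, map_withDensity_comp _ (ContinuousLinearMap.measurable _) (hpdf.const_smul _),
    map_toEuclideanCLM_volume hA, withDensity_smul_measure, withDensity_smul _ hpdf, smul_smul,
    ← ENNReal.ofReal_mul (inv_nonneg.2 hdet.le), inv_mul_cancel₀ hdet.ne', ENNReal.ofReal_one,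
    one_smul]

theorem multivariateGaussian_eq_withDensity {S : Matrix ι ι ℝ} (hS : S.PosDef) :
    multivariateGaussian 0 S =
      volume.withDensity fun y ↦ ENNReal.ofReal (multivariateGaussianPDFReal S y) := by
  have hA : (CFC.sqrt S).PosDef :=
    Matrix.isStrictlyPositive_iff_posDef.1 (Matrix.isStrictlyPositive_iff_posDef.2 hS).sqrt
  have hAA : CFC.sqrt S * (CFC.sqrt S)ᵀ = S := by
    rw [← Matrix.conjTranspose_eq_transpose_of_trivial, hA.isHermitian.eq,
      CFC.sqrt_mul_sqrt_self S hS.posSemidef.nonneg]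
  simp only [multivariateGaussian, zero_add]
  rw [map_toEuclideanCLM_stdGaussian hA.det_pos.ne'.isUnit, hAA]

theorem prod_multivariateGaussianPDFReal (S : Matrix ι ι ℝ) {κ : Type*} [Fintype κ]
    (x : κ → EuclideanSpace ℝ ι) : ∏ k, multivariateGaussianPDFReal S (x k) =
      ((√(2 * Real.pi))⁻¹ ^ Fintype.card ι * (√S.det)⁻¹) ^ Fintype.card κ *
        Real.exp (-(1 / 2) * (S⁻¹ * ∑ k, Matrix.vecMulVec (x k).ofLp (x k).ofLp).trace) := by
  simp only [multivariateGaussianPDFReal, Finset.prod_mul_distrib, Finset.prod_const,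
    Finset.card_univ, ← Real.exp_sum, mul_pow]
  congr 2
  rw [Finset.mul_sum, Matrix.trace_sum, Finset.mul_sum]
  refine Finset.sum_congr rfl fun k _ ↦ ?_
  rw [Matrix.mul_vecMulVec, Matrix.trace_vecMulVec, dotProduct_comm]

end Gaussian

section Wishart

variable {p : ℕ}

/-- The density of the Wishart distribution `W_p(m, S)` with respect to Lebesgue measure on
symmetric matrices; it vanishes off the positive definite matrices. -/
noncomputable def wishartPDFReal (p m : ℕ) (S : Matrix (Fin p) (Fin p) ℝ) :
    Matrix (Fin p) (Fin p) ℝ → ℝ :=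
  {W | W.PosDef}.indicator fun W ↦
    1 / ((2 : ℝ) ^ ((m : ℝ) * p / 2) * multivariateGamma p ((m : ℝ) / 2) *
        S.det ^ ((m : ℝ) / 2)) *
      W.det ^ ((m - p - 1 : ℝ) / 2) * Real.exp (-(1 / 2) * (S⁻¹ * W).trace)

theorem continuous_trace_mul_left (S : Matrix (Fin p) (Fin p) ℝ) :
    Continuous fun W : Matrix (Fin p) (Fin p) ℝ ↦ (S * W).trace :=
  (continuous_const.matrix_mul continuous_id).matrix_trace

theorem measurable_wishartPDFReal (m : ℕ) (S : Matrix (Fin p) (Fin p) ℝ) :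
    Measurable (wishartPDFReal p m S) := by
  have htrace := (continuous_trace_mul_left S⁻¹).measurable
  have hdet := measurable_det (p := p)
  exact Measurable.indicator (by fun_prop) (measurableSet_posDef p)

theorem gramConst_mul_gaussianConst {S : Matrix (Fin p) (Fin p) ℝ} (hS : S.PosDef) (m : ℕ) :
    gramConst p m * ((√(2 * Real.pi))⁻¹ ^ p * (√S.det)⁻¹) ^ m =
      1 / ((2 : ℝ) ^ ((m : ℝ) * p / 2) * multivariateGamma p ((m : ℝ) / 2) *
        S.det ^ ((m : ℝ) / 2)) := by
  have hdet : √S.det ^ m = S.det ^ ((m : ℝ) / 2) := by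
    rw [Real.sqrt_eq_rpow, ← Real.rpow_mul_natCast hS.det_pos.le, one_div_mul_eq_div]
  have hpow : (√(2 * Real.pi) ^ p) ^ m =
      (2 : ℝ) ^ ((m : ℝ) * p / 2) * Real.pi ^ ((m : ℝ) * p / 2) := by
    rw [← Real.mul_rpow zero_le_two Real.pi_pos.le, Real.sqrt_eq_rpow, ← pow_mul,
      ← Real.rpow_mul_natCast Real.two_pi_pos.le]
    congr 1; push_cast; ring
  rw [gramConst, mul_pow, inv_pow, inv_pow, inv_pow, hdet, hpow]
  field_simp

theorem map_sum_vecMulVec_volume (p m : ℕ) :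
    (volume : Measure (Fin m → EuclideanSpace ℝ (Fin p))).map
        (fun x ↦ ∑ i, Matrix.vecMulVec (x i).ofLp (x i).ofLp) =
      (volume : Measure (Fin p → EuclideanSpace ℝ (Fin m))).map (Matrix.gram ℝ) := by
  have htranspose := (volume_preserving_pi fun _ : Fin p ↦ PiLp.volume_preserving_toLp (Fin m)).comp
    ((measurePreserving_swap (Fin m) (Fin p) ℝ).comp
      (volume_preserving_pi fun _ : Fin m ↦ PiLp.volume_preserving_ofLp (Fin p)))
  rw [← htranspose.map_eq, Measure.map_map continuous_gram.measurable htranspose.measurable]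
  congr 1
  ext x i j
  simp [Function.swap, Matrix.sum_apply, Matrix.vecMulVec_apply, PiLp.inner_apply, mul_comm]

theorem continuous_sum_vecMulVec (p m : ℕ) :
    Continuous fun x : Fin m → EuclideanSpace ℝ (Fin p) ↦
      ∑ i, Matrix.vecMulVec (x i).ofLp (x i).ofLp :=
  continuous_finsetSum _ fun i _ ↦ by fun_prop

theorem pi_multivariateGaussian_eq_withDensity {S : Matrix (Fin p) (Fin p) ℝ} (hS : S.PosDef)
    (m : ℕ) : Measure.pi (fun _ : Fin m ↦ multivariateGaussian 0 S) =
      (volume : Measure (Fin m → EuclideanSpace ℝ (Fin p))).withDensity fun x ↦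
        ENNReal.ofReal (((√(2 * Real.pi))⁻¹ ^ p * (√S.det)⁻¹) ^ m * Real.exp (-(1 / 2) *
          (S⁻¹ * ∑ k, Matrix.vecMulVec (x k).ofLp (x k).ofLp).trace)) := by
  have hgauss := multivariateGaussian_eq_withDensity hS
  have : SigmaFinite ((volume : Measure (EuclideanSpace ℝ (Fin p))).withDensity
      fun y ↦ ENNReal.ofReal (multivariateGaussianPDFReal S y)) := hgauss ▸ inferInstance
  rw [hgauss, pi_withDensity _ fun _ ↦ by fun_prop, ← volume_pi]
  congr 1 with x
  rw [← ENNReal.ofReal_prod_of_nonneg fun i _ ↦ multivariateGaussianPDFReal_nonneg S _,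
    prod_multivariateGaussianPDFReal, Fintype.card_fin, Fintype.card_fin]

theorem ofReal_wishartPDFReal {m : ℕ} (hpm : p ≤ m) {S : Matrix (Fin p) (Fin p) ℝ}
    (hS : S.PosDef) (W : Matrix (Fin p) (Fin p) ℝ) :
    ENNReal.ofReal (gramConst p m) * detRpow ((m - p - 1 : ℝ) / 2) W *
        ENNReal.ofReal (((√(2 * Real.pi))⁻¹ ^ p * (√S.det)⁻¹) ^ m *
          Real.exp (-(1 / 2) * (S⁻¹ * W).trace)) =
      ENNReal.ofReal (wishartPDFReal p m S W) := by
  by_cases hW : W.PosDef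
  · have hdet := Real.rpow_nonneg hW.det_pos.le ((m - p - 1 : ℝ) / 2)
    have hconst := (gramConst_pos hpm).le
    rw [detRpow_of_posDef _ hW, ← ENNReal.ofReal_mul hconst,
      ← ENNReal.ofReal_mul (mul_nonneg hconst hdet), wishartPDFReal,
      Set.indicator_of_mem (show W ∈ {W | W.PosDef} from hW), ← gramConst_mul_gaussianConst hS]
    congr 1
    ring
  · rw [detRpow_of_not_posDef _ hW, wishartPDFReal,
      Set.indicator_of_notMem (show W ∉ {W | W.PosDef} from hW), ENNReal.ofReal_zero, mul_zero,
      zero_mul]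

theorem wishart_eq_withDensity {m : ℕ} (hpm : p ≤ m) {S : Matrix (Fin p) (Fin p) ℝ}
    (hS : S.PosDef) : wishart p m S =
      (symLebesgue p).withDensity fun W ↦ ENNReal.ofReal (wishartPDFReal p m S W) := by
  have hexp : Measurable fun W : Matrix (Fin p) (Fin p) ℝ ↦
      ENNReal.ofReal (((√(2 * Real.pi))⁻¹ ^ p * (√S.det)⁻¹) ^ m *
        Real.exp (-(1 / 2) * (S⁻¹ * W).trace)) :=
    (((continuous_trace_mul_left S⁻¹).measurable.const_mul _).exp.const_mul _).ennreal_ofReal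
  have hpE : p ≤ Module.finrank ℝ (EuclideanSpace ℝ (Fin m)) := by simpa using hpm
  have hgram : Measurable fun W ↦ ENNReal.ofReal (gramConst p m) *
      detRpow (p := p) ((m - p - 1 : ℝ) / 2) W := by fun_prop
  rw [wishart, pi_multivariateGaussian_eq_withDensity hS,
    map_withDensity_comp _ (continuous_sum_vecMulVec p m).measurable hexp,
    map_sum_vecMulVec_volume, map_gram_volume hpE, finrank_euclideanSpace_fin,
    ← withDensity_mul _ hgram hexp]
  exact congrArg _ (funext fun W ↦ ofReal_wishartPDFReal hpm hS W)

end Wishart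

section Lyapunov

open scoped Matrix

variable {n R : Type*} [Fintype n] [CommRing R]

/-- The Lyapunov operator `H ↦ V H + H V`, the derivative of squaring at `V`. -/
def lyapunov (V : Matrix n n R) : Matrix n n R →ₗ[R] Matrix n n R :=
  LinearMap.mulLeft R V + LinearMap.mulRight R V

theorem lyapunov_apply (V H : Matrix n n R) : lyapunov V H = V * H + H * V := rfl

/-- The congruence `H ↦ U H Uᵀ`. -/
def congruence (U : Matrix n n R) : Matrix n n R →ₗ[R] Matrix n n R :=
  LinearMap.mulLeft R U ∘ₗ LinearMap.mulRight R Uᵀ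

theorem congruence_apply (U H : Matrix n n R) : congruence U H = U * (H * Uᵀ) := rfl

theorem isSymm_lyapunov {V H : Matrix n n R} (hV : V.IsSymm) (hH : H.IsSymm) :
    (lyapunov V H).IsSymm := by
  rw [Matrix.IsSymm, lyapunov_apply, Matrix.transpose_add, Matrix.transpose_mul,
    Matrix.transpose_mul, hV.eq, hH.eq, add_comm]

theorem isSymm_congruence (U : Matrix n n R) {H : Matrix n n R} (hH : H.IsSymm) :
    (congruence U H).IsSymm := by
  rw [Matrix.IsSymm, congruence_apply, Matrix.transpose_mul, Matrix.transpose_mul,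
    Matrix.transpose_transpose, hH.eq, Matrix.mul_assoc]

theorem congruence_comp_congruence_transpose [DecidableEq n] {U : Matrix n n R} (hU : U * Uᵀ = 1) :
    congruence U ∘ₗ congruence Uᵀ = LinearMap.id := by
  refine LinearMap.ext fun H ↦ ?_
  rw [LinearMap.comp_apply, congruence_apply, congruence_apply, Matrix.transpose_transpose]
  calc U * (Uᵀ * (H * U) * Uᵀ) = (U * Uᵀ) * H * (U * Uᵀ) := by simp only [Matrix.mul_assoc]
    _ = H := by rw [hU, Matrix.one_mul, Matrix.mul_one]

theorem lyapunov_congruence [DecidableEq n] {U : Matrix n n R} (hU : U * Uᵀ = 1)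
    (V : Matrix n n R) :
    lyapunov (congruence U V) = congruence U ∘ₗ lyapunov V ∘ₗ congruence Uᵀ := by
  refine LinearMap.ext fun H ↦ ?_
  simp only [LinearMap.comp_apply, congruence_apply, lyapunov_apply, Matrix.transpose_transpose]
  calc U * (V * Uᵀ) * H + H * (U * (V * Uᵀ))
      = U * (V * Uᵀ) * H * (U * Uᵀ) + (U * Uᵀ) * H * (U * (V * Uᵀ)) := by
        rw [hU, Matrix.one_mul, Matrix.mul_one]
    _ = U * ((V * (Uᵀ * (H * U)) + Uᵀ * (H * U) * V) * Uᵀ) := by noncomm_ring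

end Lyapunov

section SymmetricCoordinates

open scoped Matrix

variable {p : ℕ}

/-- The map induced on symmetric matrices, in the coordinates `upper`, by a linear map on
matrices; it is only meaningful for maps preserving symmetric matrices. -/
def symCoord : (Matrix (Fin p) (Fin p) ℝ →ₗ[ℝ] Matrix (Fin p) (Fin p) ℝ) →ₗ[ℝ]
    (UpperIndex p → ℝ) →ₗ[ℝ] (UpperIndex p → ℝ) where
  toFun L :=
    { toFun := fun x ↦ upper (L (symOfUpper p x))
      map_add' := fun x y ↦ congrArg upper (L.map_add (symOfUpper p x) (symOfUpper p y))
      map_smul' := fun c x ↦ congrArg upper (L.map_smul c (symOfUpper p x)) }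
  map_add' _ _ := rfl
  map_smul' _ _ := rfl

theorem symCoord_apply (L : Matrix (Fin p) (Fin p) ℝ →ₗ[ℝ] Matrix (Fin p) (Fin p) ℝ)
    (x : UpperIndex p → ℝ) : symCoord L x = upper (L (symOfUpper p x)) := rfl

theorem symCoord_id : symCoord (LinearMap.id : Matrix (Fin p) (Fin p) ℝ →ₗ[ℝ] _) = LinearMap.id :=
  LinearMap.ext upper_symOfUpper

theorem symCoord_comp (L : Matrix (Fin p) (Fin p) ℝ →ₗ[ℝ] Matrix (Fin p) (Fin p) ℝ)
    {M : Matrix (Fin p) (Fin p) ℝ →ₗ[ℝ] Matrix (Fin p) (Fin p) ℝ}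
    (hM : ∀ A : Matrix (Fin p) (Fin p) ℝ, A.IsSymm → (M A).IsSymm) :
    symCoord (L ∘ₗ M) = symCoord L ∘ₗ symCoord M := by
  refine LinearMap.ext fun x ↦ ?_
  simp only [LinearMap.comp_apply, symCoord_apply, symOfUpper_upper (hM _ (isSymm_symOfUpper x))]

theorem det_symCoord_congruence_comp {U : Matrix (Fin p) (Fin p) ℝ} (hU : U * Uᵀ = 1)
    {L : Matrix (Fin p) (Fin p) ℝ →ₗ[ℝ] Matrix (Fin p) (Fin p) ℝ}
    (hL : ∀ A : Matrix (Fin p) (Fin p) ℝ, A.IsSymm → (L A).IsSymm) :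
    LinearMap.det (symCoord (congruence U ∘ₗ L ∘ₗ congruence Uᵀ)) =
      LinearMap.det (symCoord L) := by
  have hsymm (A : Matrix (Fin p) (Fin p) ℝ) (hA : A.IsSymm) := isSymm_congruence Uᵀ hA
  have hinv : LinearMap.det (symCoord (congruence U)) *
      LinearMap.det (symCoord (congruence Uᵀ)) = 1 := by
    rw [← LinearMap.det_comp, ← symCoord_comp _ hsymm, congruence_comp_congruence_transpose hU,
      symCoord_id, LinearMap.det_id]
  rw [symCoord_comp (M := L ∘ₗ congruence Uᵀ) _ fun A hA ↦ hL _ (hsymm A hA),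
    symCoord_comp _ hsymm, LinearMap.det_comp, LinearMap.det_comp, mul_left_comm, hinv, mul_one]

theorem det_symCoord_lyapunov_diagonal (d : Fin p → ℝ) :
    LinearMap.det (symCoord (lyapunov (Matrix.diagonal d))) =
      ∏ ij : UpperIndex p, (d ij.1.1 + d ij.1.2) := by
  have hdiag : symCoord (lyapunov (Matrix.diagonal d)) = Matrix.toLin' (Matrix.diagonal
      fun ij : UpperIndex p ↦ d ij.1.1 + d ij.1.2) := by
    refine LinearMap.ext fun x ↦ funext fun ij ↦ ?_
    rw [symCoord_apply, lyapunov_apply, Matrix.toLin'_apply, Matrix.mulVec_diagonal, upper,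
      Matrix.add_apply, Matrix.diagonal_mul, Matrix.mul_diagonal, symOfUpper_apply,
      upperIndex_fst_snd]
    ring
  rw [hdiag, LinearMap.det_toLin', Matrix.det_diagonal]

theorem prod_upperIndex {M : Type*} [CommMonoid M] (f : Fin p → Fin p → M) :
    ∏ ij : UpperIndex p, f ij.1.1 ij.1.2 =
      (∏ i, f i i) * ∏ ij : Fin p × Fin p with ij.1 < ij.2, f ij.1 ij.2 := by
  have hdiag : ∏ ij : Fin p × Fin p with ij.1 = ij.2, f ij.1 ij.2 = ∏ i, f i i := by
    simp [Finset.prod_filter, Fintype.prod_prod_type]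
  rw [← Finset.prod_subtype {ij : Fin p × Fin p | ij.1 ≤ ij.2} (by simp) fun ij ↦ f ij.1 ij.2]
  simp only [le_iff_eq_or_lt, Finset.filter_or]
  rw [Finset.prod_union, hdiag]
  exact Finset.disjoint_filter.2 fun ij _ heq hlt ↦ hlt.ne heq

theorem det_symCoord_lyapunov {V : Matrix (Fin p) (Fin p) ℝ} (hV : V.IsHermitian) :
    LinearMap.det (symCoord (lyapunov V)) = 2 ^ p * V.det *
      ∏ ij : Fin p × Fin p with ij.1 < ij.2, (hV.eigenvalues ij.1 + hV.eigenvalues ij.2) := by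
  set U : Matrix (Fin p) (Fin p) ℝ := hV.eigenvectorUnitary.1
  have hU : U * Uᵀ = 1 := by
    simpa [Matrix.star_eq_conjTranspose] using Unitary.coe_mul_star_self hV.eigenvectorUnitary
  have hspec : V = congruence U (Matrix.diagonal hV.eigenvalues) := by
    simpa [Unitary.conjStarAlgAut_apply, Matrix.star_eq_conjTranspose, Function.comp_def,
      congruence_apply, Matrix.mul_assoc] using hV.spectral_theorem
  have hdet : V.det = ∏ i, hV.eigenvalues i := by simpa using hV.det_eq_prod_eigenvalues
  conv_lhs => rw [hspec]
  rw [lyapunov_congruence hU, det_symCoord_congruence_comp hU fun A hA ↦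
      isSymm_lyapunov (Matrix.diagonal_transpose _) hA,
    det_symCoord_lyapunov_diagonal, prod_upperIndex fun i j ↦ hV.eigenvalues i + hV.eigenvalues j,
    hdet]
  simp only [← two_mul, Finset.prod_mul_distrib, Finset.prod_const, Finset.card_univ,
    Fintype.card_fin]

theorem hasFDerivAt_upper_symOfUpper_sq (x : UpperIndex p → ℝ) :
    HasFDerivAt (fun x ↦ upper (symOfUpper p x ^ 2))
      (LinearMap.toContinuousLinearMap (symCoord (lyapunov (symOfUpper p x)))) x := by
  refine hasFDerivAt_pi'.2 fun ij ↦ ?_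
  have hentry := HasFDerivAt.fun_sum (u := Finset.univ) fun (k : Fin p) _ ↦
    (hasFDerivAt_apply (𝕜 := ℝ) (upperIndex ij.1.1 k) x).mul
      (hasFDerivAt_apply (𝕜 := ℝ) (upperIndex k ij.1.2) x)
  refine (hentry.congr_fderiv ?_).congr_of_eventuallyEq (.of_forall fun y ↦ ?_)
  · ext1 h
    simp [symCoord_apply, lyapunov_apply, upper, Matrix.mul_apply, symOfUpper_apply,
      Finset.sum_add_distrib, mul_comm]
  · simp only [upper, sq, Matrix.mul_apply, symOfUpper_apply, Pi.mul_apply]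

theorem posDef_sq {n : Type*} [Fintype n] [DecidableEq n] {V : Matrix n n ℝ} (hV : V.PosDef) :
    (V ^ 2).PosDef := by
  refine (hV.posSemidef.pow 2).posDef_iff_det_ne_zero.2 ?_
  rw [Matrix.det_pow]
  exact pow_ne_zero _ hV.det_pos.ne'

theorem bijOn_upper_symOfUpper_sq :
    Set.BijOn (fun x ↦ upper (symOfUpper p x ^ 2)) {x | (symOfUpper p x).PosDef}
      {x | (symOfUpper p x).PosDef} := by
  refine Set.BijOn.mk (fun x hx ↦ ?_) (fun x hx y hy h ↦ ?_) fun x hx ↦ ?_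
  · rw [Set.mem_ofPred_eq, symOfUpper_upper ((isSymm_symOfUpper x).pow 2)]
    exact posDef_sq hx
  · have hsq := congrArg (symOfUpper p) h
    simp only [symOfUpper_upper ((isSymm_symOfUpper _).pow 2)] at hsq
    rw [← upper_symOfUpper x, ← CFC.sqrt_sq _ (Matrix.PosDef.posSemidef hx).nonneg, hsq,
      CFC.sqrt_sq _ (Matrix.PosDef.posSemidef hy).nonneg, upper_symOfUpper]
  · obtain ⟨hV, hsq⟩ := (eq_sqrt_iff hx).1 rfl
    have hsymm : symOfUpper p (upper (CFC.sqrt (symOfUpper p x))) = CFC.sqrt (symOfUpper p x) :=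
      symOfUpper_upper (by simpa using hV.isHermitian)
    refine ⟨upper (CFC.sqrt (symOfUpper p x)), ?_, ?_⟩
    · rwa [Set.mem_ofPred_eq, hsymm]
    · simp only [hsymm, hsq, upper_symOfUpper]

theorem setLIntegral_posDef_eq_setLIntegral_sq (g : Matrix (Fin p) (Fin p) ℝ → ENNReal) :
    ∫⁻ W in {W | W.PosDef}, g W ∂symLebesgue p = ∫⁻ V in {V | V.PosDef},
      ENNReal.ofReal |LinearMap.det (symCoord (lyapunov V))| * g (V ^ 2) ∂symLebesgue p := by
  have hmeas : MeasurableSet {x | (symOfUpper p x).PosDef} :=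
    continuous_symOfUpper.measurable (measurableSet_posDef p)
  have hsubst := lintegral_image_eq_lintegral_abs_det_fderiv_mul volume hmeas
    (fun x _ ↦ (hasFDerivAt_upper_symOfUpper_sq x).hasFDerivWithinAt)
    bijOn_upper_symOfUpper_sq.injOn fun x ↦ g (symOfUpper p x)
  simp only [symOfUpper_upper ((isSymm_symOfUpper _).pow 2),
    bijOn_upper_symOfUpper_sq.image_eq] at hsubst
  rw [symLebesgue, measurableEmbedding_symOfUpper.restrict_map,
    measurableEmbedding_symOfUpper.lintegral_map, measurableEmbedding_symOfUpper.lintegral_map]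
  exact hsubst

end SymmetricCoordinates

section SquareRoot

variable {p m : ℕ} {S : Matrix (Fin p) (Fin p) ℝ}

open Matrix.Norms.L2Operator in
theorem measurable_sqrt :
    Measurable (CFC.sqrt : Matrix (Fin p) (Fin p) ℝ → Matrix (Fin p) (Fin p) ℝ) := by
  classical
  have hmeas : MeasurableSet {W : Matrix (Fin p) (Fin p) ℝ | 0 ≤ W} := by
    simpa only [Matrix.nonneg_iff_posSemidef] using (isClosed_posSemidef (Fin p)).measurableSet
  have hpiecewise : CFC.sqrt = {W : Matrix (Fin p) (Fin p) ℝ | 0 ≤ W}.piecewise CFC.sqrt 0 :=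
    funext fun W ↦ by
      by_cases hW : 0 ≤ W <;> simp [hW, CFC.sqrt_of_not_nonneg]
  rw [hpiecewise]
  exact CFC.continuousOn_sqrt.measurable_piecewise continuousOn_const hmeas

theorem sqrtDensity_of_posDef (p m : ℕ) (S : Matrix (Fin p) (Fin p) ℝ)
    {V : Matrix (Fin p) (Fin p) ℝ} (hV : V.PosDef) :
    sqrtDensity p m S V =
      |LinearMap.det (symCoord (lyapunov V))| * wishartPDFReal p m S (V ^ 2) := by
  have hdet := hV.det_pos
  have hprod : 0 ≤ ∏ ij : Fin p × Fin p with ij.1 < ij.2,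
      (hV.isHermitian.eigenvalues ij.1 + hV.isHermitian.eigenvalues ij.2) :=
    Finset.prod_nonneg fun ij _ ↦ add_nonneg (hV.eigenvalues_pos _).le (hV.eigenvalues_pos _).le
  have hpow : V.det * (V ^ 2).det ^ ((m - p - 1 : ℝ) / 2) = V.det ^ ((m : ℝ) - p) := by
    rw [Matrix.det_pow, ← Real.rpow_natCast_mul hdet.le, mul_comm, ← Real.rpow_add_one hdet.ne']
    congr 1; push_cast; ring
  rw [sqrtDensity, dif_pos hV, wishartPDFReal,
    Set.indicator_of_mem (show V ^ 2 ∈ {W | W.PosDef} from posDef_sq hV),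
    det_symCoord_lyapunov hV.isHermitian, abs_of_nonneg (by positivity), ← hpow]
  ring

theorem sqrtDensity_of_not_posDef (p m : ℕ) (S : Matrix (Fin p) (Fin p) ℝ)
    {V : Matrix (Fin p) (Fin p) ℝ} (hV : ¬ V.PosDef) : sqrtDensity p m S V = 0 := dif_neg hV

theorem continuous_det_symCoord_lyapunov :
    Continuous fun V : Matrix (Fin p) (Fin p) ℝ ↦ LinearMap.det (symCoord (lyapunov V)) := by
  simp only [← LinearMap.det_toMatrix']
  refine Continuous.matrix_det (continuous_matrix fun i j ↦ ?_)
  simp only [LinearMap.toMatrix'_apply, symCoord_apply, lyapunov_apply, upper]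
  fun_prop

theorem measurable_sqrtDensity (p m : ℕ) (S : Matrix (Fin p) (Fin p) ℝ) :
    Measurable (sqrtDensity p m S) := by
  have hindicator : sqrtDensity p m S = {V | V.PosDef}.indicator fun V ↦
      |LinearMap.det (symCoord (lyapunov V))| * wishartPDFReal p m S (V ^ 2) := by
    funext V
    by_cases hV : V.PosDef
    · rw [sqrtDensity_of_posDef p m S hV, Set.indicator_of_mem (show V ∈ {V | V.PosDef} from hV)]
    · rw [sqrtDensity_of_not_posDef p m S hV,
        Set.indicator_of_notMem (show V ∉ {V | V.PosDef} from hV)]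
  have hsq : Continuous fun V : Matrix (Fin p) (Fin p) ℝ ↦ V ^ 2 := by fun_prop
  rw [hindicator]
  exact (continuous_det_symCoord_lyapunov.abs.measurable.mul
    ((measurable_wishartPDFReal m S).comp hsq.measurable)).indicator (measurableSet_posDef p)

theorem map_sqrt_wishart (hpm : p ≤ m) (hS : S.PosDef) :
    (wishart p m S).map CFC.sqrt =
      (symLebesgue p).withDensity fun V ↦ ENNReal.ofReal (sqrtDensity p m S V) := by
  refine Measure.ext_of_lintegral _ fun g hg ↦ ?_
  have hPD := measurableSet_posDef p
  have hpdf := (measurable_wishartPDFReal m S).ennreal_ofReal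
  have hdensity := (measurable_sqrtDensity p m S).ennreal_ofReal
  rw [lintegral_map hg measurable_sqrt, wishart_eq_withDensity hpm hS,
    lintegral_withDensity_eq_lintegral_mul _ hpdf (g := fun W ↦ g (CFC.sqrt W))
      (hg.comp measurable_sqrt),
    lintegral_withDensity_eq_lintegral_mul _ hdensity hg]
  simp only [Pi.mul_apply]
  calc ∫⁻ W, ENNReal.ofReal (wishartPDFReal p m S W) * g (CFC.sqrt W) ∂symLebesgue p
      = ∫⁻ W in {W | W.PosDef},
          ENNReal.ofReal (wishartPDFReal p m S W) * g (CFC.sqrt W) ∂symLebesgue p := by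
        symm
        refine setLIntegral_eq_of_support_subset (Function.support_subset_iff'.2 fun W hW ↦ ?_)
        rw [wishartPDFReal, Set.indicator_of_notMem hW, ENNReal.ofReal_zero, zero_mul]
    _ = ∫⁻ V in {V | V.PosDef}, ENNReal.ofReal |LinearMap.det (symCoord (lyapunov V))| *
          (ENNReal.ofReal (wishartPDFReal p m S (V ^ 2)) * g (CFC.sqrt (V ^ 2)))
          ∂symLebesgue p := setLIntegral_posDef_eq_setLIntegral_sq _
    _ = ∫⁻ V in {V | V.PosDef}, ENNReal.ofReal (sqrtDensity p m S V) * g V ∂symLebesgue p := by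
        refine setLIntegral_congr_fun hPD fun V (hV : V.PosDef) ↦ ?_
        rw [sqrtDensity_of_posDef p m S hV, ENNReal.ofReal_mul (abs_nonneg _),
          CFC.sqrt_sq V hV.posSemidef.nonneg, mul_assoc]
    _ = ∫⁻ V, ENNReal.ofReal (sqrtDensity p m S V) * g V ∂symLebesgue p := by
        refine setLIntegral_eq_of_support_subset (Function.support_subset_iff'.2 fun V hV ↦ ?_)
        rw [sqrtDensity_of_not_posDef p m S hV, ENNReal.ofReal_zero, zero_mul]

end SquareRoot

end WishartSqrt

theorem mainTheorem1 {Ω : Type*} [MeasurableSpace Ω] (P : Measure Ω) [IsProbabilityMeasure P]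
    (p m : ℕ) (hpm : p ≤ m) (S : Matrix (Fin p) (Fin p) ℝ) (hS : S.PosDef)
    (W V : Ω → Matrix (Fin p) (Fin p) ℝ)
    (hW : HasLaw W (WishartSqrt.wishart p m S) P)
    (hV : ∀ ω, V ω = CFC.sqrt (W ω)) :
    HasPDF V P (WishartSqrt.symLebesgue p) ∧
      pdf V P (WishartSqrt.symLebesgue p) =ᵐ[WishartSqrt.symLebesgue p]
        fun A => ENNReal.ofReal (WishartSqrt.sqrtDensity p m S A) := by
  obtain rfl : V = CFC.sqrt ∘ W := funext hV
  have hsqrt := WishartSqrt.measurable_sqrt (p := p)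
  have hmap : P.map (CFC.sqrt ∘ W) = (WishartSqrt.symLebesgue p).withDensity
      fun A ↦ ENNReal.ofReal (WishartSqrt.sqrtDensity p m S A) := by
    rw [← AEMeasurable.map_map_of_aemeasurable hsqrt.aemeasurable hW.aemeasurable, hW.map_eq,
      WishartSqrt.map_sqrt_wishart hpm hS]
  have hdensity := (WishartSqrt.measurable_sqrtDensity p m S).ennreal_ofReal.aemeasurable
    (μ := WishartSqrt.symLebesgue p)
  have hpdf := hasPDF_of_map_eq_withDensity (hsqrt.comp_aemeasurable hW.aemeasurable) _
    hdensity hmap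
  exact ⟨hpdf, (pdf.eq_of_map_eq_withDensity _ hdensity).1 hmap⟩
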